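/- **Setting.** For every $n$ let $c=c_n:[n]\to[\kappa]$, with $\kappa=\kappa_n$, be a community assignment, $(p_{ab})_{a,b\in[\kappa]}$ a symmetric matrix with entries in $[0,1]$, and $s_1,s_2\in[0,1)$ (all may depend on $n$). The random graph $G$ on $[n]$ is drawn from the stochastic block model: each pair $u\ne v$ is an edge independently with probability $p_{c(u)c(v)}$. Each edge of $G$ is kept in $G_1$ with probability $s_1$ and in $\tilde G_2$ with probability $s_2$, all choices independent. Let $\pi_0$ be a permutation of $[n]$ with $c(\pi_0(i))=c(i)$ for all $i$ (the true mapping), and let $G_2$ be $\tilde G_2$ with every node $i$ relabelled $\pi_0(i)$. Let $E_1,E_2$ be the edge sets of $G_1,G_2$. Let $\Pi$ be the set of permutations $\pi$ of $[n]$ with $c(\pi(i))=c(i)$ for all $i$, and for $\pi\in\Pi$ put $$\Delta_\pi=\sum_{i\le j}w_{ij}\,\bigl|\mathbf 1\{(i,j)\in E_1\}-\mathbf 1\{(\pi(i),\pi(j))\in E_2\}\bigr|,\qquad w_{ij}=\log\frac{1-p_{c(i)c(j)}(s_1+s_2-s_1s_2)}{p_{c(i)c(j)}(1-s_1)(1-s_2)}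 .$$ Let $\alpha=\min_{a,b}p_{ab}$ and $\beta=\max_{a,b}p_{ab}$. **Theorem 4.1.** There is an absolute constant $C>0$ such that the following holds for all such sequences of models and true mappings and every real sequence $\gamma=\gamma_n$. Assume that $\alpha\to0$ and $\beta\to0$, that neither $s_1$ nor $s_2$ tends to $1$ as $n\to\infty$, that $\frac{\log\alpha}{\log\beta}\le\gamma$ for all large $n$, and that $$\frac{\alpha(1-\beta)^2s_1^2s_2^2\log(1/\alpha)}{s_1+s_2}=f(n)+g(n)\quad\text{for all large } n,$$ where $f(n)\ge C\,\gamma\log^2n/n$ for all large $n$ and $g(n)=\omega(1/n)$, that is, $n\,g(n)\to+\infty$. Then, with probability tending to $1$ as $n\to\infty$, $\pi_0$ is the unique minimizer of $\Delta_\pi$ over $\pi\in\Pi$. -/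

import Mathlib

open MeasureTheory Filter Topology

namespace Deanon

/-- The parameters of the model on `n` nodes: `κ` communities, the community assignment `c`,
the symmetric matrix of affinity values `p` and the two sampling probabilities. -/
structure Params (n : ℕ) where
  κ : ℕ
  c : Fin n → Fin κ
  p : Fin κ → Fin κ → ℝ
  p_symm : ∀ a b, p a b = p b a
  p_mem : ∀ a b, p a b ∈ Set.Icc (0 : ℝ) 1
  s₁ : ℝ
  s₂ : ℝ
  s₁_mem : s₁ ∈ Set.Icc (0 : ℝ) 1
  s₂_mem : s₂ ∈ Set.Icc (0 : ℝ) 1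

/-- The law of a Bernoulli variable with mean `q` (for `0 ≤ q ≤ 1`). -/
noncomputable def bernoulliLaw (q : ℝ) : Measure Bool :=
  q.toNNReal • Measure.dirac true + (1 - q).toNNReal • Measure.dirac false

/-- An elementary outcome: for every unordered pair of nodes three bits, saying whether the pair
is an edge of the underlying network, whether the first sampling keeps it, and whether the second
sampling keeps it. The bits at the diagonal pairs are never used. -/
abbrev Outcome (n : ℕ) : Type := Sym2 (Fin n) → Bool × Bool × Bool

/-- The simple graph whose edges are the pairs of distinct nodes at which `f` is true. -/
def graphOf {n : ℕ} (f : Sym2 (Fin n) → Bool) : SimpleGraph (Fin n) where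
  Adj u v := u ≠ v ∧ f s(u, v) = true
  symm := ⟨fun u v h => ⟨h.1.symm, by rw [Sym2.eq_swap]; exact h.2⟩⟩
  loopless := ⟨fun _ h => h.1 rfl⟩

/-- The underlying social network `G`. -/
def underlying {n : ℕ} (ω : Outcome n) : SimpleGraph (Fin n) :=
  graphOf fun e => (ω e).1

/-- The published network `G₁`: a sample of the edges of `G`, with the node labels of `G`. -/
def published {n : ℕ} (ω : Outcome n) : SimpleGraph (Fin n) :=
  graphOf fun e => (ω e).1 && (ω e).2.1

/-- The auxiliary network `G₂`: a second sample of the edges of `G`, its nodes relabelled by the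
correct mapping `π₀`, so that `π₀ u` and `π₀ v` are adjacent in `G₂` exactly when the pair `u`, `v`
is an edge of `G` that the second sampling keeps. -/
def auxiliary {n : ℕ} (π₀ : Equiv.Perm (Fin n)) (ω : Outcome n) : SimpleGraph (Fin n) :=
  (graphOf fun e => (ω e).1 && (ω e).2.2).map π₀.toEmbedding

open Classical in
/-- The indicator of the event that `u`, `v` is an edge of `H`. -/
noncomputable def edgeInd {n : ℕ} (H : SimpleGraph (Fin n)) (u v : Fin n) : ℝ :=
  if H.Adj u v then 1 else 0

namespace Params

variable {n : ℕ} (P : Params n)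

/-- The probability that a pair of nodes is an edge of `G`. -/
def pairProb : Sym2 (Fin n) → ℝ :=
  Sym2.lift ⟨fun u v => P.p (P.c u) (P.c v), fun u v => P.p_symm (P.c u) (P.c v)⟩

/-- The stochastic block model together with the two independent edge samplings: all the bits are
independent, with means `p_{c(u)c(v)}`, `s₁`, `s₂`. -/
noncomputable def law : Measure (Outcome n) :=
  Measure.pi fun e =>
    (bernoulliLaw (P.pairProb e)).prod ((bernoulliLaw P.s₁).prod (bernoulliLaw P.s₂))

/-- The smallest affinity value. -/
noncomputable def α : ℝ := ⨅ ab : Fin P.κ × Fin P.κ, P.p ab.1 ab.2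

/-- The largest affinity value. -/
noncomputable def β : ℝ := ⨆ ab : Fin P.κ × Fin P.κ, P.p ab.1 ab.2

/-- The weight of the pair `i`, `j`. -/
noncomputable def w (i j : Fin n) : ℝ :=
  Real.log ((1 - P.p (P.c i) (P.c j) * (P.s₁ + P.s₂ - P.s₁ * P.s₂)) /
    (P.p (P.c i) (P.c j) * (1 - P.s₁) * (1 - P.s₂)))

/-- The mappings that observe the community assignment. -/
def mappings : Set (Equiv.Perm (Fin n)) := {π | ∀ i, P.c i = P.c (π i)}

/-- The cost `Δ_π`: the weighted edge disagreements of `G₁` and `G₂` under `π`. -/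
noncomputable def cost (G₁ G₂ : SimpleGraph (Fin n)) (π : Equiv.Perm (Fin n)) : ℝ :=
  ∑ ij : Fin n × Fin n with ij.1 ≤ ij.2,
    P.w ij.1 ij.2 * |edgeInd G₁ ij.1 ij.2 - edgeInd G₂ (π ij.1) (π ij.2)|

/-- `π` is the minimizer of the cost over the mappings that observe the community assignment:
it is one of them, and every other one has a larger cost. -/
def IsTheMinimizer (G₁ G₂ : SimpleGraph (Fin n)) (π : Equiv.Perm (Fin n)) : Prop :=
  π ∈ P.mappings ∧ ∀ π' ∈ P.mappings, π' ≠ π → P.cost G₁ G₂ π < P.cost G₁ G₂ π'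

end Params

end Deanon

/-! Chernoff's bound for each competing mapping, followed by a union bound. Write σ = π₀⁻¹π, let A_e
and B_e indicate that the pair e is an edge kept by the first and by the second sampling, and let
w_e be its weight. Since w is σ-invariant, the cost difference reduces to twice the gain Σ w_e A_e
(B_{σe} - B_e) (`cost_sub_cost`).

Grouping outcomes by the bits b = B, independence turns E exp(gain/2) into Σ_b ∏_e T_e(b_e, b_{σe})
with 2 × 2 matrices T_e that are constant along the cycles of σ on pairs (`sum_exp_gain`). Each T_e
has trace 1, and off the diagonal its determinant is at least p s₁ s₂ / 4 (`transfer_det_ge`). A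
diagonal conjugation makes T_e symmetric, with squared Frobenius norm 1 - 2 det T_e, so every moved
pair contributes a factor at most exp(-det T_e) (`sum_prod_perm_le_exp_det`).

A permutation with k non-fixed points moves at least k(n - 2)/2 pairs, so its failure probability is
at most x^k with x = exp(-δ(n - 2)/2), δ = α s₁ s₂ / 4. Summing over σ ≠ 1 gives at most (1 + nx)^n
- 1, which vanishes once x ≤ n⁻³. The density hypothesis supplies this: γ ≥ 1, and one factor log n
cancels against log(1/α) (`le_of_log_sq_le`). -/

namespace Deanon

/-! ### Products of matrix entries along the cycles of a permutation -/

/-- The Frobenius norm of a real square matrix. -/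
noncomputable def frob {S : Type*} [Fintype S] (M : Matrix S S ℝ) : ℝ :=
  √(∑ i, ∑ j, M i j ^ 2)

theorem frob_nonneg {S : Type*} [Fintype S] (M : Matrix S S ℝ) : 0 ≤ frob M :=
  Real.sqrt_nonneg _

theorem frob_mul_le {S : Type*} [Fintype S] (M N : Matrix S S ℝ) :
    frob (M * N) ≤ frob M * frob N := by
  unfold frob
  rw [← Real.sqrt_mul (by positivity)]
  apply Real.sqrt_le_sqrt
  rw [Finset.sum_comm (f := fun i j => N i j ^ 2), Finset.sum_mul_sum]
  refine Finset.sum_le_sum fun i _ => Finset.sum_le_sum fun j _ => ?_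
  rw [Matrix.mul_apply]
  exact Finset.sum_mul_sq_le_sq_mul_sq _ _ _

/-- Cauchy–Schwarz over `S × S`. It handles the 2-cycles, which become fixed points when one of
their two points is removed. -/
theorem trace_mul_le_frob {S : Type*} [Fintype S] (M N : Matrix S S ℝ) :
    (M * N).trace ≤ frob M * frob N := by
  unfold frob
  rw [← Real.sqrt_mul (by positivity)]
  apply Real.le_sqrt_of_sq_le
  rw [Finset.sum_comm (f := fun i j => N i j ^ 2)]
  simp only [Matrix.trace, Matrix.diag, Matrix.mul_apply]
  simp only [← Finset.sum_product']
  exact Finset.sum_mul_sq_le_sq_mul_sq _ _ _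

open Classical in
/-- The factor that an index contributes to the bound on a permutation-indexed product. -/
noncomputable def permFactor {α S : Type*} [Fintype S] (σ : Equiv.Perm α)
    (F : α → Matrix S S ℝ) (a : α) : ℝ :=
  if σ a = a then (F a).trace else frob (F a)

theorem permFactor_nonneg {α S : Type*} [Fintype S] (σ : Equiv.Perm α)
    (F : α → Matrix S S ℝ) (hF : ∀ a i j, 0 ≤ F a i j) (a : α) : 0 ≤ permFactor σ F a := by
  unfold permFactor
  split_ifs
  · exact Finset.sum_nonneg fun i _ => hF a i i
  · exact frob_nonneg _

/-- Induction step removing the point `none`. If it is fixed, summing over its value splits off a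
trace. If it lies on a cycle y → none → x, that sum is a matrix product: y inherits `F (some y) * F
none`, and the cycle gets shorter. -/
theorem sum_prod_perm_le_option {α S : Type*} [Fintype α] [Fintype S] [DecidableEq α]
    (ih : ∀ (σ : Equiv.Perm α) (F : α → Matrix S S ℝ), (∀ a i j, 0 ≤ F a i j) →
      ∑ b : α → S, ∏ a, F a (b a) (b (σ a)) ≤ ∏ a, permFactor σ F a)
    (σ : Equiv.Perm (Option α)) (F : Option α → Matrix S S ℝ) (hF : ∀ a i j, 0 ≤ F a i j) :
    ∑ b : Option α → S, ∏ a, F a (b a) (b (σ a)) ≤ ∏ a, permFactor σ F a := by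
  classical
  have hsum : ∑ b : Option α → S, ∏ a, F a (b a) (b (σ a)) =
      ∑ b : α → S, ∑ s : S, F none s ((σ none).elim s b) *
        ∏ a, F (some a) (b a) ((σ (some a)).elim s b) := by
    rw [← (Equiv.piOptionEquivProd (β := fun _ : Option α => S)).symm.sum_comp,
      Fintype.sum_prod_type_right]
    refine Finset.sum_congr rfl fun b _ => Finset.sum_congr rfl fun s _ => ?_
    rw [Fintype.prod_option]
    have key : ∀ o : Option α, (Equiv.piOptionEquivProd (β := fun _ : Option α => S)).symm (s, b) o
        = o.elim s b := by
      intro o; cases o <;> rfl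
    simp only [key]
    rfl
  rw [hsum, Fintype.prod_option]
  set τ := Equiv.removeNone σ with hτ
  cases hx : σ none with
  | none =>
    have hs : ∀ a, σ (some a) = some (τ a) := fun a => by
      have : ∃ z, σ (some a) = some z := by
        cases h : σ (some a) with
        | none => exact absurd (σ.injective (h.trans hx.symm)) (by simp)
        | some z => exact ⟨z, rfl⟩
      exact (Equiv.removeNone_some σ this).symm
    simp only [hs, Option.elim]
    have h1 : permFactor σ F none = (F none).trace := by simp [permFactor, hx]
    have h2 : ∀ a, permFactor σ F (some a) = permFactor τ (fun a => F (some a)) a := by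
      intro a; simp [permFactor, hs]
    simp only [h1, h2, ← Finset.sum_mul, ← Finset.mul_sum]
    exact mul_le_mul_of_nonneg_left (ih τ (fun a => F (some a)) fun a => hF _)
      (Finset.sum_nonneg fun i _ => hF _ i i)
  | some x =>
    obtain ⟨y, hy⟩ : ∃ y, σ (some y) = none := by
      obtain ⟨o, ho⟩ := σ.surjective none
      cases o with
      | none => simp [hx] at ho
      | some y => exact ⟨y, ho⟩
    have hτy : τ y = x := by
      have := Equiv.removeNone_none σ hy
      rw [hx] at this
      exact Option.some_injective _ this
    have hs : ∀ a, a ≠ y → σ (some a) = some (τ a) := fun a ha => by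
      have : ∃ z, σ (some a) = some z := by
        cases h : σ (some a) with
        | none => exact absurd (Option.some_injective _ (σ.injective (h.trans hy.symm))) ha
        | some z => exact ⟨z, rfl⟩
      exact (Equiv.removeNone_some σ this).symm
    set F' : α → Matrix S S ℝ := Function.update (fun a => F (some a)) y (F (some y) * F none)
      with hF'
    have hF'y : F' y = F (some y) * F none := by simp [hF']
    have hF'a : ∀ a, a ≠ y → F' a = F (some a) := fun a ha => by simp [hF', ha]
    have hF'0 : ∀ a i j, 0 ≤ F' a i j := by
      intro a i j
      by_cases ha : a = y
      · subst ha
        rw [hF'y, Matrix.mul_apply]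
        exact Finset.sum_nonneg fun k _ => mul_nonneg (hF _ _ _) (hF _ _ _)
      · rw [hF'a a ha]; exact hF _ _ _
    have hin : ∀ b : α → S, ∑ s : S, F none s ((some x).elim s b) *
        ∏ a, F (some a) (b a) ((σ (some a)).elim s b) = ∏ a, F' a (b a) (b (τ a)) := by
      intro b
      rw [← Finset.mul_prod_erase _ _ (Finset.mem_univ y), hF'y, Matrix.mul_apply, Finset.sum_mul]
      refine Finset.sum_congr rfl fun s _ => ?_
      rw [← Finset.mul_prod_erase _ _ (Finset.mem_univ y), hy, hτy]
      have : ∏ a ∈ Finset.univ.erase y, F (some a) (b a) ((σ (some a)).elim s b) =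
          ∏ a ∈ Finset.univ.erase y, F' a (b a) (b (τ a)) := by
        refine Finset.prod_congr rfl fun a ha => ?_
        have ha := (Finset.mem_erase.1 ha).1
        rw [hs a ha, hF'a a ha]; rfl
      rw [this]
      simp only [Option.elim]
      ring
    simp only [hin]
    refine (ih τ F' hF'0).trans ?_
    rw [← Finset.mul_prod_erase _ _ (Finset.mem_univ y),
      ← Finset.mul_prod_erase _ (fun a => permFactor σ F (some a)) (Finset.mem_univ y), ← mul_assoc]
    have hrest : ∏ a ∈ Finset.univ.erase y, permFactor τ F' a =
        ∏ a ∈ Finset.univ.erase y, permFactor σ F (some a) := by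
      refine Finset.prod_congr rfl fun a ha => ?_
      have ha := (Finset.mem_erase.1 ha).1
      simp [permFactor, hs a ha, hF'a a ha]
    rw [hrest]
    refine mul_le_mul_of_nonneg_right ?_
      (Finset.prod_nonneg fun a _ => permFactor_nonneg σ F hF _)
    have h1 : permFactor σ F none = frob (F none) := by simp [permFactor, hx]
    have h2 : permFactor σ F (some y) = frob (F (some y)) := by simp [permFactor, hy]
    rw [h1, h2, mul_comm, permFactor, hF'y]
    split_ifs
    · exact trace_mul_le_frob _ _
    · exact frob_mul_le _ _

/-- Summing over all configurations a product of nonnegative matrix entries along the cycles of a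
permutation is bounded by the traces at the fixed points and the Frobenius norms elsewhere. -/
theorem sum_prod_perm_le {α S : Type*} [Fintype α] [Fintype S] [DecidableEq α]
    (σ : Equiv.Perm α) (F : α → Matrix S S ℝ) (hF : ∀ a i j, 0 ≤ F a i j) :
    ∑ b : α → S, ∏ a, F a (b a) (b (σ a)) ≤ ∏ a, permFactor σ F a := by
  classical
  have main : ∀ (n : ℕ) (α : Type _) [Fintype α] [DecidableEq α], Fintype.card α = n →
      ∀ (σ : Equiv.Perm α) (F : α → Matrix S S ℝ), (∀ a i j, 0 ≤ F a i j) →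
      ∑ b : α → S, ∏ a, F a (b a) (b (σ a)) ≤ ∏ a, permFactor σ F a := by
    intro n
    induction n with
    | zero =>
      intro α _ _ h σ F hF
      have := Fintype.card_eq_zero_iff.1 h
      simp
    | succ n ih =>
      intro α _ _ h σ F hF
      obtain ⟨e⟩ : Nonempty (α ≃ Option (Fin n)) := Fintype.card_eq.1 (by simp [h])
      -- `ULift` keeps the index type in the universe over which the induction hypothesis is
      -- quantified.
      have := sum_prod_perm_le_option (α := ULift (Fin n)) (S := S)
        (fun σ F hF => ih _ (by simp) σ F hF)
      set e' : α ≃ Option (ULift (Fin n)) := e.trans (Equiv.optionCongr Equiv.ulift.symm)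
      have := this (e'.permCongr σ) (fun a => F (e'.symm a)) (fun a => hF _)
      convert this using 1
      · rw [← (e'.arrowCongr (Equiv.refl S)).sum_comp]
        refine Finset.sum_congr rfl fun b _ => ?_
        rw [← e'.prod_comp]
        simp
      · rw [← e'.prod_comp]
        refine Finset.prod_congr rfl fun a _ => ?_
        by_cases h : σ a = a <;> simp [permFactor, h]
  exact main _ α rfl σ F hF

end Deanon

/-! ### Determinants and the transfer matrix of a pair -/

namespace Deanon

/-- Permutation-indexed products of positive `2 × 2` matrices of trace one that are constant along
the cycles are bounded through the determinants. -/
theorem sum_prod_perm_le_exp_det {α : Type*} [Fintype α] [DecidableEq α] (σ : Equiv.Perm α)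
    (N : α → Matrix Bool Bool ℝ) (hinv : ∀ a, N (σ a) = N a) (hpos : ∀ a i j, 0 < N a i j)
    (htr : ∀ a, N a false false + N a true true = 1) (D : α → ℝ)
    (hD : ∀ a, D a ≤ N a false false * N a true true - N a false true * N a true false) :
    ∑ b : α → Bool, ∏ a, N a (b a) (b (σ a)) ≤
      Real.exp (-∑ a with σ a ≠ a, D a) := by
  -- Conjugating by diag(1, φ) makes both off-diagonal entries √(N₀₁ N₁₀). As φ is constant along
  -- cycles, the conjugating factors cancel in the product.
  set φ : α → Bool → ℝ := fun a b => bif b then √(N a false true / N a true false) else 1 with hφ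
  have hφpos : ∀ a b, 0 < φ a b := by
    intro a b
    cases b
    · simp [hφ]
    · exact Real.sqrt_pos.2 (div_pos (hpos _ _ _) (hpos _ _ _))
  set F : α → Matrix Bool Bool ℝ := fun a => .of fun i j => N a i j * φ a i / φ a j with hF
  have hconj : ∀ b : α → Bool, ∏ a, N a (b a) (b (σ a)) = ∏ a, F a (b a) (b (σ a)) := by
    intro b
    simp only [hF, Matrix.of_apply, Finset.prod_div_distrib, Finset.prod_mul_distrib]
    have : ∏ a, φ a (b (σ a)) = ∏ a, φ a (b a) := by
      rw [← Equiv.prod_comp σ (fun a => φ a (b a))]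
      refine Finset.prod_congr rfl fun a _ => ?_
      simp only [hφ, hinv]
    rw [this, mul_div_assoc, div_self (Finset.prod_pos fun a _ => hφpos _ _).ne', mul_one]
  simp only [hconj]
  refine (sum_prod_perm_le σ F fun a i j => ?_).trans ?_
  · exact (div_pos (mul_pos (hpos _ _ _) (hφpos _ _)) (hφpos _ _)).le
  rw [← Finset.sum_neg_distrib, Real.exp_sum, Finset.prod_filter]
  refine Finset.prod_le_prod (fun a _ => permFactor_nonneg _ _
    (fun a i j => (div_pos (mul_pos (hpos _ _ _) (hφpos _ _)) (hφpos _ _)).le) _) fun a _ => ?_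
  have h01 := hpos a false true
  have h10 := hpos a true false
  have hφt := hφpos a true
  have hsq : φ a true ^ 2 = N a false true / N a true false :=
    Real.sq_sqrt (div_pos h01 h10).le
  have hφf : φ a false = 1 := rfl
  by_cases h : σ a = a
  · simp only [permFactor, h, if_true, not_true, if_false, ne_eq]
    have : (F a).trace = N a true true + N a false false := by
      simp [Matrix.trace, hF, hφf, hφt.ne']
    rw [this, add_comm, htr]
  · simp only [permFactor, h, if_false, not_false_eq_true, if_true, ne_eq]
    unfold frob
    -- For the symmetric matrix F this sum is tr(F²) = (tr F)² - 2 det F.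
    have hfr : ∑ i, ∑ j, F a i j ^ 2 = 1 - 2 * (N a false false * N a true true -
        N a false true * N a true false) := by
      simp only [Fintype.sum_bool, hF, Matrix.of_apply, hφf, mul_pow, div_pow,
        hsq]
      field_simp
      have := htr a
      have h2 : N a true true = 1 - N a false false := by linarith
      rw [h2]; ring
    rw [hfr]
    refine Real.sqrt_le_iff.2 ⟨(Real.exp_pos _).le, ?_⟩
    rw [← Real.exp_nat_mul]
    have := Real.add_one_le_exp ((2 : ℕ) * -D a)
    have := hD a
    push_cast at *
    linarith

/-- The mass that the Bernoulli law of mean `q` gives to a bit. -/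
def bernMass (q : ℝ) (b : Bool) : ℝ := bif b then q else 1 - q

/-- The joint mass of the three bits of a pair. -/
def bitMass (p s₁ s₂ : ℝ) (x : Bool × Bool × Bool) : ℝ :=
  bernMass p x.1 * (bernMass s₁ x.2.1 * bernMass s₂ x.2.2)

/-- The real indicator of a bit. -/
def bitInd (b : Bool) : ℝ := bif b then 1 else 0

/-- The matrix describing the contribution of a pair to the exponential moment, given the presence
of that pair and of its image in the second sample. -/
noncomputable def transfer (p s₁ s₂ θ : ℝ) : Matrix Bool Bool ℝ :=
  .of fun b b' => ∑ x : Bool × Bool × Bool with (x.1 && x.2.2) = b,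
    bitMass p s₁ s₂ x * Real.exp (θ * (bitInd (x.1 && x.2.1) * (bitInd b' - bitInd b)))

theorem transfer_false_false (p s₁ s₂ θ : ℝ) :
    transfer p s₁ s₂ θ false false = 1 - p * s₂ := by
  simp [transfer, Finset.sum_filter, Fintype.sum_prod_type, bitMass, bernMass]
  ring

theorem transfer_true_true (p s₁ s₂ θ : ℝ) : transfer p s₁ s₂ θ true true = p * s₂ := by
  simp [transfer, Finset.sum_filter, Fintype.sum_prod_type, bitMass, bernMass]
  ring

theorem transfer_false_true (p s₁ s₂ θ : ℝ) :
    transfer p s₁ s₂ θ false true =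
      (1 - p * (s₁ + s₂ - s₁ * s₂)) + p * s₁ * (1 - s₂) * Real.exp θ := by
  simp [transfer, Finset.sum_filter, Fintype.sum_prod_type, bitMass, bernMass, bitInd]
  ring

theorem transfer_true_false (p s₁ s₂ θ : ℝ) :
    transfer p s₁ s₂ θ true false =
      p * s₂ * (1 - s₁) + p * s₁ * s₂ * Real.exp (-θ) := by
  simp [transfer, Finset.sum_filter, Fintype.sum_prod_type, bitMass, bernMass, bitInd]
  ring

/-- Strict positivity is what allows the symmetrizing conjugation, which divides by entries. -/
theorem transfer_pos {p s₁ s₂ : ℝ} (hp : 0 < p) (hp1 : p < 1) (h₁ : 0 < s₁) (h₁' : s₁ < 1)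
    (h₂ : 0 < s₂) (h₂' : s₂ < 1) (θ : ℝ) (b b' : Bool) : 0 < transfer p s₁ s₂ θ b b' := by
  have e1 := Real.exp_pos θ
  have e2 := Real.exp_pos (-θ)
  have q1 : 0 < 1 - s₁ := by linarith
  have q2 : 0 < 1 - s₂ := by linarith
  have q3 : 0 < 1 - p := by linarith
  cases b <;> cases b'
  · rw [transfer_false_false]; nlinarith
  · rw [transfer_false_true]
    have : 1 - p * (s₁ + s₂ - s₁ * s₂) = (1 - p) + p * ((1 - s₁) * (1 - s₂)) := by ring
    rw [this]; positivity
  · rw [transfer_true_false]; positivity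
  · rw [transfer_true_true]; positivity

theorem transfer_trace (p s₁ s₂ θ : ℝ) :
    transfer p s₁ s₂ θ false false + transfer p s₁ s₂ θ true true = 1 := by
  rw [transfer_false_false, transfer_true_true]; ring

/-- At θ = 0 the entry is the probability of b alone, so the two columns agree. This is the case of
diagonal pairs, whose weight is zero. -/
theorem transfer_det_zero (p s₁ s₂ : ℝ) :
    transfer p s₁ s₂ 0 false false * transfer p s₁ s₂ 0 true true -
      transfer p s₁ s₂ 0 false true * transfer p s₁ s₂ 0 true false = 0 := by
  rw [transfer_false_false, transfer_true_true, transfer_false_true, transfer_true_false]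
  simp; ring

/-- At half the log-likelihood weight, the determinant of the transfer matrix is of the order of the
probability that the pair is present in both samples. -/
theorem transfer_det_ge {p s₁ s₂ : ℝ} (hp : 0 < p) (hp1 : p ≤ 1 / 6) (h₁ : 0 < s₁) (h₁' : s₁ < 1)
    (h₂ : 0 < s₂) (h₂' : s₂ < 1) {θ : ℝ}
    (hθ : θ = Real.log ((1 - p * (s₁ + s₂ - s₁ * s₂)) / (p * (1 - s₁) * (1 - s₂))) / 2) :
    p * s₁ * s₂ / 4 ≤ transfer p s₁ s₂ θ false false * transfer p s₁ s₂ θ true true -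
      transfer p s₁ s₂ θ false true * transfer p s₁ s₂ θ true false := by
  have q1 : 0 < 1 - s₁ := by linarith
  have q2 : 0 < 1 - s₂ := by linarith
  have hsub : 0 ≤ s₁ + s₂ - s₁ * s₂ := by nlinarith
  have hsub1 : s₁ + s₂ - s₁ * s₂ ≤ 1 := by nlinarith
  have hA : 1 - p ≤ 1 - p * (s₁ + s₂ - s₁ * s₂) := by nlinarith
  set A := 1 - p * (s₁ + s₂ - s₁ * s₂) with hAdef
  have hA0 : 0 < A := by linarith
  set B := p * (1 - s₁) * (1 - s₂) with hB
  have hB0 : 0 < B := by positivity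
  have hB1 : B ≤ p := by
    rw [hB, mul_assoc]
    exact mul_le_of_le_one_right hp.le (mul_le_one₀ (by linarith) q2.le (by linarith))
  have hlog : θ = Real.log (√A / √B) := by
    rw [hθ, ← Real.sqrt_div hA0.le, Real.log_sqrt (by positivity)]
  have ra := Real.sqrt_pos.2 hA0
  have rb := Real.sqrt_pos.2 hB0
  have hexp : Real.exp θ = √A / √B := by rw [hlog, Real.exp_log (by positivity)]
  have hexp' : Real.exp (-θ) = √B / √A := by rw [Real.exp_neg, hexp, inv_div]
  have sa : √A * √A = A := Real.mul_self_sqrt hA0.le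
  have sb : √B * √B = B := Real.mul_self_sqrt hB0.le
  rw [transfer_false_false, transfer_true_true, transfer_false_true, transfer_true_false, hexp,
    hexp', ← hAdef]
  have e1 : A * (√B / √A) = √A * √B := by
    rw [← sa]; field_simp; rw [Real.sqrt_sq ra.le]
  have e2 : B * (√A / √B) = √A * √B := by
    rw [← sb]; field_simp; rw [Real.sqrt_sq rb.le]
  have e3 : √A / √B * (√B / √A) = 1 := by field_simp
  -- As a function of θ the determinant is p s₁ s₂ (A + B - A e^{-θ} - B e^θ), maximal at θ =
  -- log(A/B)/2, where it equals p s₁ s₂ (√A - √B)².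
  have key : (1 - p * s₂) * (p * s₂) - (A + p * s₁ * (1 - s₂) * (√A / √B)) *
      (p * s₂ * (1 - s₁) + p * s₁ * s₂ * (√B / √A)) =
      (p * s₁ * s₂) * (A + B - 2 * (√A * √B)) := by
    have x1 : (A + p * s₁ * (1 - s₂) * (√A / √B)) *
      (p * s₂ * (1 - s₁) + p * s₁ * s₂ * (√B / √A)) =
      A * (p * s₂ * (1 - s₁)) + p * s₁ * s₂ * (A * (√B / √A)) +
        p * s₁ * s₂ * (B * (√A / √B)) +
        p * s₁ * (1 - s₂) * (p * s₁ * s₂) * (√A / √B * (√B / √A)) := by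
      rw [hB]; ring
    rw [x1, e1, e2, e3, hB, hAdef]; ring
  rw [key]
  -- The square gives the lower bound A/2 - B ≥ (1 - p)/2 - p, which is at least 1/4 exactly when p
  -- ≤ 1/6.
  have : (1 : ℝ) / 4 ≤ A + B - 2 * (√A * √B) := by
    nlinarith [sq_nonneg (√A - 2 * √B)]
  have hps : 0 < p * s₁ * s₂ := by positivity
  nlinarith

end Deanon

/-! ### From costs to gains -/

namespace Deanon

/-- The permutation of the unordered pairs induced by a permutation of the nodes. -/
def pairPerm {α : Type*} (σ : Equiv.Perm α) : Equiv.Perm (Sym2 α) where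
  toFun := Sym2.map σ
  invFun := Sym2.map σ.symm
  left_inv e := by simp [Sym2.map_map]
  right_inv e := by simp [Sym2.map_map]

theorem pairPerm_mk {α : Type*} (σ : Equiv.Perm α) (i j : α) :
    pairPerm σ s(i, j) = s(σ i, σ j) := rfl

theorem isDiag_pairPerm {α : Type*} (σ : Equiv.Perm α) (e : Sym2 α) :
    (pairPerm σ e).IsDiag ↔ e.IsDiag := by
  induction e with | _ i j => simp [pairPerm_mk]

/-- Linearizes the disagreement: after weighting and summing over pairs, only the product term
depends on the mapping. -/
theorem abs_bitInd_sub (a b : Bool) :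
    |bitInd a - bitInd b| = bitInd a + bitInd b - 2 * (bitInd a * bitInd b) := by
  cases a <;> cases b <;> norm_num [bitInd]

theorem bernMass_nonneg {q : ℝ} (hq : q ∈ Set.Icc (0 : ℝ) 1) (b : Bool) : 0 ≤ bernMass q b := by
  cases b
  · simpa [bernMass] using hq.2
  · simpa [bernMass] using hq.1

theorem bernoulliLaw_singleton {q : ℝ} (b : Bool) :
    bernoulliLaw q {b} = ENNReal.ofReal (bernMass q b) := by
  rw [bernoulliLaw, Measure.add_apply, Measure.smul_apply, Measure.smul_apply]
  cases b <;> simp [bernMass, ENNReal.ofReal, ENNReal.smul_def]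

theorem isProbabilityMeasure_bernoulliLaw {q : ℝ} (hq : q ∈ Set.Icc (0 : ℝ) 1) :
    IsProbabilityMeasure (bernoulliLaw q) := by
  refine ⟨?_⟩
  rw [← Finset.coe_univ, ← sum_measure_singleton, Fintype.sum_bool, bernoulliLaw_singleton,
    bernoulliLaw_singleton, ← ENNReal.ofReal_add (bernMass_nonneg hq _) (bernMass_nonneg hq _)]
  simp [bernMass]

namespace Params

variable {n : ℕ} (P : Params n)

theorem pairProb_mem (e : Sym2 (Fin n)) : P.pairProb e ∈ Set.Icc (0 : ℝ) 1 := by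
  induction e with | _ i j => exact P.p_mem _ _

theorem pairProb_pairPerm {σ : Equiv.Perm (Fin n)} (hσ : σ ∈ P.mappings) (e : Sym2 (Fin n)) :
    P.pairProb (pairPerm σ e) = P.pairProb e := by
  induction e with
  | _ i j =>
    have h : ∀ i, P.c (σ i) = P.c i := fun i => (hσ i).symm
    change P.p (P.c (σ i)) (P.c (σ j)) = P.p (P.c i) (P.c j)
    rw [h, h]

instance isProbabilityMeasure_law : IsProbabilityMeasure P.law := by
  have h1 := isProbabilityMeasure_bernoulliLaw P.s₁_mem
  have h2 := isProbabilityMeasure_bernoulliLaw P.s₂_mem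
  have h3 := fun e => isProbabilityMeasure_bernoulliLaw (P.pairProb_mem e)
  unfold law
  infer_instance

theorem law_real_singleton (ω : Outcome n) :
    P.law.real {ω} = ∏ e, bitMass (P.pairProb e) P.s₁ P.s₂ (ω e) := by
  have h1 := isProbabilityMeasure_bernoulliLaw P.s₁_mem
  have h2 := isProbabilityMeasure_bernoulliLaw P.s₂_mem
  have h3 := fun e => isProbabilityMeasure_bernoulliLaw (P.pairProb_mem e)
  rw [measureReal_def, law, Measure.pi_singleton, ENNReal.toReal_prod]
  refine Finset.prod_congr rfl fun e _ => ?_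
  have : ({ω e} : Set (Bool × Bool × Bool)) = {(ω e).1} ×ˢ ({(ω e).2.1} ×ˢ {(ω e).2.2}) := by
    ext ⟨a, b, c⟩; simp [Prod.ext_iff]
  rw [this, Measure.prod_prod, Measure.prod_prod, ENNReal.toReal_mul, ENNReal.toReal_mul,
    bernoulliLaw_singleton, bernoulliLaw_singleton, bernoulliLaw_singleton,
    ENNReal.toReal_ofReal (bernMass_nonneg (P.pairProb_mem e) _),
    ENNReal.toReal_ofReal (bernMass_nonneg P.s₁_mem _),
    ENNReal.toReal_ofReal (bernMass_nonneg P.s₂_mem _), bitMass]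

open Classical in
/-- The weight of an unordered pair, set to zero on the diagonal. -/
noncomputable def pairWeight (e : Sym2 (Fin n)) : ℝ :=
  if e.IsDiag then 0 else
    Real.log ((1 - P.pairProb e * (P.s₁ + P.s₂ - P.s₁ * P.s₂)) /
      (P.pairProb e * (1 - P.s₁) * (1 - P.s₂)))

theorem pairWeight_pairPerm {σ : Equiv.Perm (Fin n)} (hσ : σ ∈ P.mappings) (e : Sym2 (Fin n)) :
    P.pairWeight (pairPerm σ e) = P.pairWeight e := by
  simp only [pairWeight, P.pairProb_pairPerm hσ, isDiag_pairPerm]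

/-- Half the difference between the cost of the true mapping and that of its composition
with `σ`. -/
noncomputable def gain (σ : Equiv.Perm (Fin n)) (ω : Outcome n) : ℝ :=
  ∑ e, P.pairWeight e * (bitInd ((ω e).1 && (ω e).2.1) *
    (bitInd ((ω (pairPerm σ e)).1 && (ω (pairPerm σ e)).2.2) - bitInd ((ω e).1 && (ω e).2.2)))

/-- Undoing the relabelling by π₀ leaves a dependence on π only through π₀⁻¹π. Diagonal terms vanish
because the graphs are loopless, in agreement with the zero diagonal of `pairWeight`. -/
theorem cost_eq_sum_sym2 (π₀ π : Equiv.Perm (Fin n)) (ω : Outcome n) :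
    P.cost (published ω) (auxiliary π₀ ω) π = ∑ e, P.pairWeight e *
      |bitInd ((ω e).1 && (ω e).2.1) - bitInd ((ω (pairPerm (π₀⁻¹ * π) e)).1 &&
        (ω (pairPerm (π₀⁻¹ * π) e)).2.2)| := by
  classical
  have hdiag : ∑ e, P.pairWeight e * |bitInd ((ω e).1 && (ω e).2.1) -
      bitInd ((ω (pairPerm (π₀⁻¹ * π) e)).1 && (ω (pairPerm (π₀⁻¹ * π) e)).2.2)| =
      ∑ e ∈ (Finset.univ : Finset (Fin n)).sym2 with ¬ e.IsDiag, P.pairWeight e *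
        |bitInd ((ω e).1 && (ω e).2.1) - bitInd ((ω (pairPerm (π₀⁻¹ * π) e)).1 &&
          (ω (pairPerm (π₀⁻¹ * π) e)).2.2)| := by
    rw [Finset.sym2_univ, Finset.sum_filter]
    refine Finset.sum_congr rfl fun e _ => ?_
    by_cases h : e.IsDiag <;> simp [h, pairWeight]
  rw [hdiag, Finset.sum_sym2_filter_not_isDiag, cost]
  symm
  refine (Finset.sum_congr rfl ?_).trans (Finset.sum_subset (s₁ := Finset.univ.offDiag.filter
    fun ij : Fin n × Fin n => ij.1 < ij.2) ?_ ?_)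
  · rintro ⟨i, j⟩ hij
    have hlt : i ≠ j := by simpa using (Finset.mem_filter.1 hij).2.ne
    have hA : edgeInd (published ω) i j = bitInd ((ω s(i, j)).1 && (ω s(i, j)).2.1) := by
      have hadj : (published ω).Adj i j ↔ ((ω s(i, j)).1 && (ω s(i, j)).2.1) = true :=
        and_iff_right hlt
      simp only [edgeInd, hadj, bitInd]
      cases (ω s(i, j)).1 && (ω s(i, j)).2.1 <;> simp
    have hB : edgeInd (auxiliary π₀ ω) (π i) (π j) =
        bitInd ((ω (pairPerm (π₀⁻¹ * π) s(i, j))).1 && (ω (pairPerm (π₀⁻¹ * π) s(i, j))).2.2) := by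
      have hadj : (auxiliary π₀ ω).Adj (π i) (π j) ↔
          ((ω (pairPerm (π₀⁻¹ * π) s(i, j))).1 && (ω (pairPerm (π₀⁻¹ * π) s(i, j))).2.2) = true := by
        rw [auxiliary, SimpleGraph.map_adj]
        constructor
        · rintro ⟨u, v, huv, hu, hv⟩
          have hu' : u = (π₀⁻¹ * π) i := by simp [← hu]
          have hv' : v = (π₀⁻¹ * π) j := by simp [← hv]
          rw [pairPerm_mk, ← hu', ← hv']
          exact huv.2
        · intro h
          refine ⟨(π₀⁻¹ * π) i, (π₀⁻¹ * π) j, ⟨by simpa using hlt, h⟩, by simp, by simp⟩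
      simp only [edgeInd, hadj, bitInd]
      cases (ω (pairPerm (π₀⁻¹ * π) s(i, j))).1 && (ω (pairPerm (π₀⁻¹ * π) s(i, j))).2.2 <;> simp
    have hW : P.pairWeight s(i, j) = P.w i j := by
      simp only [pairWeight, Sym2.mk_isDiag_iff, hlt, if_false]; rfl
    simp only [hA, hB, hW]
  · intro ij h
    simp only [Finset.mem_filter, Finset.mem_univ, true_and] at h ⊢
    exact h.2.le
  · rintro ⟨i, j⟩ h h'
    have hij : i = j := by
      simp only [Finset.mem_filter, Finset.mem_univ, true_and, Finset.mem_offDiag] at h h'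
      by_contra hne
      exact h' ⟨hne, lt_of_le_of_ne h hne⟩
    subst hij
    simp [edgeInd]

/-- Reindexing by σ preserves the total weight of the second sample, so the linear terms of the two
costs cancel. -/
theorem cost_sub_cost {π₀ π : Equiv.Perm (Fin n)} (h₀ : π₀⁻¹ * π ∈ P.mappings) (ω : Outcome n) :
    P.cost (published ω) (auxiliary π₀ ω) π₀ - P.cost (published ω) (auxiliary π₀ ω) π =
      2 * P.gain (π₀⁻¹ * π) ω := by
  rw [cost_eq_sum_sym2, cost_eq_sum_sym2, inv_mul_cancel]
  have h1 : ∀ e : Sym2 (Fin n), pairPerm 1 e = e := fun e => by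
    induction e with | _ i j => rfl
  simp only [h1, abs_bitInd_sub, gain]
  set σ := π₀⁻¹ * π
  have hswap : ∑ e, P.pairWeight e * bitInd ((ω (pairPerm σ e)).1 && (ω (pairPerm σ e)).2.2) =
      ∑ e, P.pairWeight e * bitInd ((ω e).1 && (ω e).2.2) := by
    rw [← Equiv.sum_comp (pairPerm σ) (fun e => P.pairWeight e * bitInd ((ω e).1 && (ω e).2.2))]
    simp only [P.pairWeight_pairPerm h₀]
  rw [← sub_eq_zero] at hswap
  rw [← sub_eq_zero, ← neg_eq_zero, ← hswap, Finset.mul_sum, ← Finset.sum_sub_distrib,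
    ← Finset.sum_sub_distrib, ← Finset.sum_sub_distrib, ← Finset.sum_neg_distrib]
  refine Finset.sum_congr rfl fun e _ => ?_
  ring

theorem inv_mul_mem_mappings {π₀ π : Equiv.Perm (Fin n)} (h₀ : π₀ ∈ P.mappings)
    (h : π ∈ P.mappings) : π₀⁻¹ * π ∈ P.mappings := by
  intro i
  rw [h i, h₀ ((π₀⁻¹ * π) i)]
  simp

/-- If the true mapping is not the minimizer, some other mapping has a nonnegative gain. -/
theorem exists_gain_nonneg {π₀ : Equiv.Perm (Fin n)} (h₀ : π₀ ∈ P.mappings) {ω : Outcome n}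
    (h : ¬ P.IsTheMinimizer (published ω) (auxiliary π₀ ω) π₀) :
    ∃ σ ∈ P.mappings, σ ≠ 1 ∧ 0 ≤ P.gain σ ω := by
  simp only [IsTheMinimizer, h₀, true_and, not_forall, not_lt] at h
  obtain ⟨π, hπ, hne, hle⟩ := h
  refine ⟨π₀⁻¹ * π, P.inv_mul_mem_mappings h₀ hπ, ?_, ?_⟩
  · rw [Ne, inv_mul_eq_one]; exact fun h => hne h.symm
  · have := P.cost_sub_cost (P.inv_mul_mem_mappings h₀ hπ) ω
    linarith

/-! ### The exponential moment of the gain -/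

theorem law_real_le_sum_exp (S : Set (Outcome n)) (Z : Outcome n → ℝ) (hZ : ∀ ω ∈ S, 0 ≤ Z ω) :
    P.law.real S ≤ ∑ ω, P.law.real {ω} * Real.exp (Z ω) := by
  classical
  rw [← Set.coe_toFinset S, ← sum_measureReal_singleton]
  refine (Finset.sum_le_sum fun ω hω => ?_).trans (Finset.sum_le_sum_of_subset_of_nonneg
    (Finset.subset_univ _) fun ω _ _ => mul_nonneg measureReal_nonneg (Real.exp_pos _).le)
  exact le_mul_of_one_le_right measureReal_nonneg
    (Real.one_le_exp (hZ ω (Set.mem_toFinset.1 hω)))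

/-- Once the bits b of the second sample are fixed, the factor of e involves only `ω e`, `b e` and
`b (pairPerm σ e)`, so the sum over outcomes factorizes over pairs. -/
theorem sum_exp_gain {σ : Equiv.Perm (Fin n)} :
    ∑ ω, P.law.real {ω} * Real.exp (P.gain σ ω / 2) = ∑ b : Sym2 (Fin n) → Bool,
      ∏ e, transfer (P.pairProb e) P.s₁ P.s₂ (P.pairWeight e / 2) (b e) (b (pairPerm σ e)) := by
  classical
  have hterm : ∀ ω : Outcome n, P.law.real {ω} * Real.exp (P.gain σ ω / 2) =
      ∏ e, bitMass (P.pairProb e) P.s₁ P.s₂ (ω e) * Real.exp (P.pairWeight e / 2 *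
        (bitInd ((ω e).1 && (ω e).2.1) *
          (bitInd ((ω (pairPerm σ e)).1 && (ω (pairPerm σ e)).2.2) -
            bitInd ((ω e).1 && (ω e).2.2)))) := by
    intro ω
    rw [Finset.prod_mul_distrib, law_real_singleton, ← Real.exp_sum, gain, Finset.sum_div]
    congr 2
    exact Finset.sum_congr rfl fun e _ => by ring
  simp only [hterm, transfer, Matrix.of_apply, Finset.prod_univ_sum]
  rw [← Finset.sum_fiberwise (s := Finset.univ) (g := fun (ω : Outcome n) e =>
    (ω e).1 && (ω e).2.2)]
  refine Finset.sum_congr rfl fun b _ => Finset.sum_congr ?_ fun ω hω => ?_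
  · ext ω
    simp [funext_iff, Fintype.mem_piFinset]
  · have hb : ∀ e, ((ω e).1 && (ω e).2.2) = b e := by
      simpa [Fintype.mem_piFinset] using hω
    simp only [hb]

/-- The probability that a given mapping beats the true one. -/
theorem law_real_gain_nonneg_le {σ : Equiv.Perm (Fin n)} (hσ : σ ∈ P.mappings)
    (hp : ∀ a b, 0 < P.p a b) (hp' : ∀ a b, P.p a b ≤ 1 / 6) (h₁ : 0 < P.s₁) (h₁' : P.s₁ < 1)
    (h₂ : 0 < P.s₂) (h₂' : P.s₂ < 1) {δ : ℝ} (hδ : ∀ a b, δ ≤ P.p a b * P.s₁ * P.s₂ / 4) :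
    P.law.real {ω | 0 ≤ P.gain σ ω} ≤
      Real.exp (-(δ * {e : Sym2 (Fin n) | ¬ e.IsDiag ∧ pairPerm σ e ≠ e}.ncard)) := by
  classical
  -- Halving the gain puts θ = w/2 in the transfer matrices, the value that maximizes their
  -- determinants.
  refine (P.law_real_le_sum_exp _ (fun ω => P.gain σ ω / 2) fun ω hω => ?_).trans ?_
  · exact div_nonneg hω zero_le_two
  rw [sum_exp_gain]
  have hpe : ∀ e, 0 < P.pairProb e := fun e => by induction e with | _ i j => exact hp _ _
  have hpe' : ∀ e, P.pairProb e ≤ 1 / 6 := fun e => by induction e with | _ i j => exact hp' _ _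
  have hδe : ∀ e, δ ≤ P.pairProb e * P.s₁ * P.s₂ / 4 := fun e => by
    induction e with | _ i j => exact hδ _ _
  refine (sum_prod_perm_le_exp_det (pairPerm σ)
    (fun e => transfer (P.pairProb e) P.s₁ P.s₂ (P.pairWeight e / 2)) (fun e => ?_)
    (fun e => transfer_pos (hpe e) (by linarith [hpe' e]) h₁ h₁' h₂ h₂' _)
    (fun e => transfer_trace _ _ _ _) (fun e => if e.IsDiag then 0 else δ) fun e => ?_).trans ?_
  · simp only [P.pairProb_pairPerm hσ, P.pairWeight_pairPerm hσ]
  · split_ifs with h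
    · have : P.pairWeight e = 0 := by simp [pairWeight, h]
      rw [this, zero_div, transfer_det_zero]
    · refine (hδe e).trans (transfer_det_ge (hpe e) (hpe' e) h₁ h₁' h₂ h₂' ?_)
      simp [pairWeight, h]
  · apply le_of_eq
    congr 2
    rw [Finset.sum_ite, Finset.sum_const_zero, zero_add, Finset.sum_const, nsmul_eq_mul, mul_comm,
      Finset.filter_filter, ← Set.ncard_coe_finset]
    congr 3
    ext e; simp [and_comm]

end Params

/-! ### Counting moved pairs and permutations -/

/-- A permutation of `n` points with `k` non-fixed points moves at least `k (n - 2) / 2` pairs. -/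
theorem card_support_mul_le {n : ℕ} (σ : Equiv.Perm (Fin n)) :
    σ.support.card * (n - 2) ≤ 2 * {e : Sym2 (Fin n) | ¬ e.IsDiag ∧ pairPerm σ e ≠ e}.ncard := by
  classical
  rw [Set.ncard_eq_toFinset_card']
  -- If i is not fixed and j is neither i nor σ i, then σ i ∉ {i, j}, so the pair moves. Each
  -- unordered pair arises from at most two such (i, j).
  set T := σ.support.sigma fun i => (Finset.univ : Finset (Fin n)) \ {i, σ i}
  have hT : σ.support.card * (n - 2) = T.card := by
    rw [Finset.card_sigma, Finset.sum_congr rfl (g := fun _ => n - 2), Finset.sum_const,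
      smul_eq_mul]
    intro i hi
    rw [Finset.card_sdiff_of_subset (Finset.subset_univ _), Finset.card_univ, Fintype.card_fin,
      Finset.card_pair (Equiv.Perm.mem_support.1 hi).symm]
  rw [hT]
  refine Finset.card_le_mul_card_image_of_maps_to (f := fun x => s(x.1, x.2)) ?_ 2 ?_
  · rintro ⟨i, j⟩ h
    simp only [T, Finset.mem_sigma, Equiv.Perm.mem_support, Finset.mem_sdiff, Finset.mem_univ,
      true_and, Finset.mem_insert, Finset.mem_singleton, not_or] at h
    simp only [Set.mem_toFinset, Set.mem_ofPred_eq, Sym2.mk_isDiag_iff, pairPerm_mk, ne_eq,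
      Sym2.eq_iff]
    grind
  · intro e _
    induction e with
    | _ i j =>
      refine (Finset.card_le_card (t := {⟨i, j⟩, ⟨j, i⟩}) ?_).trans Finset.card_le_two
      rintro ⟨a, b⟩ h
      have := (Finset.mem_filter.1 h).2
      simp only [Sym2.eq_iff] at this
      rcases this with ⟨rfl, rfl⟩ | ⟨rfl, rfl⟩ <;> simp

/-- Summing a weight `x` for each non-fixed point over the nontrivial permutations. -/
theorem sum_pow_card_support_le {n : ℕ} {x : ℝ} (hx : 0 ≤ x) :
    ∑ σ : Equiv.Perm (Fin n) with σ ≠ 1, x ^ σ.support.card ≤ (1 + n * x) ^ n - 1 := by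
  classical
  -- The sum over permutations is the permanent of y; enlarging it to all functions gives the
  -- product of the row sums.
  set y : Fin n → Fin n → ℝ := fun i j => if j = i then 1 else x with hy
  have hy0 : ∀ i j, 0 ≤ y i j := by
    intro i j
    simp only [hy]
    split_ifs
    exacts [zero_le_one, hx]
  have hrow : ∀ i, ∑ j, y i j ≤ 1 + n * x := by
    intro i
    calc ∑ j, y i j ≤ ∑ j : Fin n, ((if j = i then 1 else 0) + x) := by
          refine Finset.sum_le_sum fun j _ => ?_
          simp only [hy]
          split_ifs
          · exact le_add_of_nonneg_right hx
          · rw [zero_add]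
      _ = 1 + n * x := by simp [Finset.sum_add_distrib]
  have htot : ∑ σ : Equiv.Perm (Fin n), x ^ σ.support.card ≤ (1 + n * x) ^ n := by
    have h1 : ∀ σ : Equiv.Perm (Fin n), x ^ σ.support.card = ∏ i, y i (σ i) := by
      intro σ
      simp only [hy]
      rw [Finset.prod_ite, Finset.prod_const_one, one_mul, Finset.prod_const]
      congr 2
    calc ∑ σ : Equiv.Perm (Fin n), x ^ σ.support.card
        = ∑ h ∈ Finset.univ.image (fun σ : Equiv.Perm (Fin n) => (σ : Fin n → Fin n)),
            ∏ i, y i (h i) := by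
          rw [Finset.sum_image fun σ _ τ _ h => DFunLike.coe_injective h]
          exact Finset.sum_congr rfl fun σ _ => h1 σ
      _ ≤ ∑ h : Fin n → Fin n, ∏ i, y i (h i) :=
          Finset.sum_le_sum_of_subset_of_nonneg (Finset.subset_univ _) fun h _ _ =>
            Finset.prod_nonneg fun i _ => hy0 _ _
      _ = ∏ i : Fin n, ∑ j : Fin n, y i j := (Fintype.prod_sum _).symm
      _ ≤ ∏ i : Fin n, (1 + n * x) :=
          Finset.prod_le_prod (fun i _ => Finset.sum_nonneg fun j _ => hy0 _ _) fun i _ => hrow i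
      _ = (1 + n * x) ^ n := by simp
  have hsplit := Finset.sum_filter_add_sum_filter_not Finset.univ
    (fun σ : Equiv.Perm (Fin n) => σ ≠ 1) (fun σ => x ^ σ.support.card)
  have h1 : ∑ σ : Equiv.Perm (Fin n) with ¬ σ ≠ 1, x ^ σ.support.card = 1 := by
    have : (Finset.univ.filter fun σ : Equiv.Perm (Fin n) => ¬ σ ≠ 1) = {1} := by
      ext σ; simp
    rw [this]; simp
  linarith

end Deanon

/-! ### Numerical estimates and the union bound -/

namespace Deanon

/-- A lower bound on the signal turns into one where the logarithm of the edge density is replaced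
by that of the size. -/
theorem le_of_log_sq_le {a s n C : ℝ} (hC : 1 ≤ C) (ha : 0 < a) (ha1 : a < 1) (hs : 0 ≤ s)
    (hs1 : s ≤ 1) (hn : 3 ≤ n)
    (h : C * Real.log n ^ 2 / n ≤ a * s * Real.log (1 / a) / 2) :
    C * Real.log n / n ≤ a * s := by
  have hn0 : 0 < n := by linarith
  have hlog : 1 ≤ Real.log n := by
    rw [Real.le_log_iff_exp_le hn0]
    linarith [Real.exp_one_lt_d9]
  have has : 0 ≤ a * s := mul_nonneg ha.le hs
  by_cases hcase : Real.log (1 / a) ≤ 2 * Real.log n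
  · have h1 : C * Real.log n ^ 2 / n ≤ a * s * Real.log n := by
      refine h.trans ?_
      have := mul_le_mul_of_nonneg_left hcase has
      linarith
    have h2 : C * Real.log n / n * Real.log n ≤ a * s * Real.log n := by
      calc _ = C * Real.log n ^ 2 / n := by ring
        _ ≤ _ := h1
    exact le_of_mul_le_mul_right h2 (by linarith)
  · exfalso
    push Not at hcase
    set r := √a with hr
    have hr0 : 0 < r := Real.sqrt_pos.2 ha
    have hrr : r * r = a := Real.mul_self_sqrt ha.le
    have hla : Real.log (1 / a) = 2 * Real.log (1 / r) := by
      rw [← hrr, one_div, one_div, Real.log_inv, Real.log_inv, Real.log_mul hr0.ne' hr0.ne']; ring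
    have hrn : 1 / r > n := by
      have : Real.log n < Real.log (1 / r) := by linarith
      exact (Real.log_lt_log_iff hn0 (by positivity)).1 this
    have hrn' : r < 1 / n := by
      rw [gt_iff_lt, lt_div_iff₀ hr0] at hrn
      rw [lt_div_iff₀ hn0]; linarith
    have hlr : Real.log (1 / r) ≤ 1 / r := (Real.log_le_sub_one_of_pos (by positivity)).trans
      (by linarith)
    have h1 : a * s * Real.log (1 / a) / 2 ≤ r := by
      have hl0 : 0 ≤ Real.log (1 / a) := Real.log_nonneg (by rw [le_div_iff₀ ha]; linarith)
      calc a * s * Real.log (1 / a) / 2 ≤ a * 1 * Real.log (1 / a) / 2 := by gcongr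
        _ = a * Real.log (1 / r) := by rw [hla]; ring
        _ ≤ a * (1 / r) := by gcongr
        _ = r := by rw [← hrr]; field_simp
    have h2 : 1 / n ≤ C * Real.log n ^ 2 / n := by
      gcongr
      nlinarith
    linarith

theorem one_add_pow_sub_one_le {n : ℕ} (hn : 0 < n) {x : ℝ} (hx0 : 0 ≤ x)
    (hx : x ≤ Real.exp (-(3 * Real.log n))) :
    (1 + n * x) ^ n - 1 ≤ Real.exp (1 / (n : ℝ)) - 1 := by
  have hn' : (0 : ℝ) < n := by exact_mod_cast hn
  have h1 : Real.exp (-(3 * Real.log n)) = 1 / (n : ℝ) ^ 3 := by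
    rw [Real.exp_neg, mul_comm, Real.exp_mul, Real.exp_log hn']
    norm_cast
    rw [one_div]
  rw [h1] at hx
  have h2 : (1 + n * x) ^ n ≤ Real.exp (n * x) ^ n := by
    gcongr
    linarith [Real.add_one_le_exp (n * x)]
  have h3 : Real.exp (n * x) ^ n ≤ Real.exp (1 / (n : ℝ)) := by
    rw [← Real.exp_nat_mul]
    apply Real.exp_le_exp.2
    calc (n : ℝ) * (n * x) ≤ n * (n * (1 / (n : ℝ) ^ 3)) := by gcongr
      _ = 1 / n := by field_simp
  linarith

namespace Params

variable {n : ℕ} (P : Params n)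

theorem α_le (a b : Fin P.κ) : P.α ≤ P.p a b :=
  ciInf_le (f := fun ab : Fin P.κ × Fin P.κ => P.p ab.1 ab.2) (Set.finite_range _).bddBelow (a, b)

theorem le_β (a b : Fin P.κ) : P.p a b ≤ P.β :=
  le_ciSup (f := fun ab : Fin P.κ × Fin P.κ => P.p ab.1 ab.2) (Set.finite_range _).bddAbove (a, b)

theorem α_nonneg : 0 ≤ P.α := Real.iInf_nonneg fun _ => (P.p_mem _ _).1

/-- When the joint sampling density is at least of order `log n / n`, the true mapping fails to be
the minimizer with small probability. -/
theorem law_real_not_minimizer_le {π₀ : Equiv.Perm (Fin n)} (h₀ : π₀ ∈ P.mappings) (hn : 4 ≤ n)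
    (hα : 0 < P.α) (hβ : P.β ≤ 1 / 6) (h₁ : 0 < P.s₁) (h₁' : P.s₁ < 1)
    (h₂ : 0 < P.s₂) (h₂' : P.s₂ < 1) (hden : 48 * Real.log n / n ≤ P.α * (P.s₁ * P.s₂)) :
    P.law.real {ω | ¬ P.IsTheMinimizer (published ω) (auxiliary π₀ ω) π₀} ≤
      Real.exp (1 / (n : ℝ)) - 1 := by
  classical
  have hn' : (0 : ℝ) < n := by positivity
  have hn4 : (4 : ℝ) ≤ n := by exact_mod_cast hn
  set δ := P.α * P.s₁ * P.s₂ / 4 with hδ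
  have hδ0 : 0 ≤ δ := by positivity
  set x := Real.exp (-(δ * ((n : ℝ) - 2) / 2)) with hx
  have hsub : {ω | ¬ P.IsTheMinimizer (published ω) (auxiliary π₀ ω) π₀} ⊆
      ⋃ σ ∈ Finset.univ.filter (fun σ : Equiv.Perm (Fin n) => σ ≠ 1),
        {ω | σ ∈ P.mappings ∧ 0 ≤ P.gain σ ω} := by
    intro ω hω
    obtain ⟨σ, hσ, hne, hg⟩ := P.exists_gain_nonneg h₀ hω
    simp only [Set.mem_iUnion]
    exact ⟨σ, by simpa using hne, hσ, hg⟩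
  refine (measureReal_mono hsub (measure_ne_top _ _)).trans ((measureReal_biUnion_finset_le _ _).trans ?_)
  refine (Finset.sum_le_sum (g := fun σ => x ^ σ.support.card) fun σ _ => ?_).trans
    ((sum_pow_card_support_le (Real.exp_pos _).le).trans
      (one_add_pow_sub_one_le (by omega) (Real.exp_pos _).le ?_))
  · by_cases hσ : σ ∈ P.mappings
    · simp only [hσ, true_and]
      refine (P.law_real_gain_nonneg_le hσ (fun a b => hα.trans_le (P.α_le a b))
        (fun a b => (P.le_β a b).trans hβ) h₁ h₁' h₂ h₂' (δ := δ) fun a b => ?_).trans ?_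
      · have := P.α_le a b
        rw [hδ]; gcongr
      · rw [hx, ← Real.exp_nat_mul]
        apply Real.exp_le_exp.2
        have hc : (σ.support.card : ℝ) * ((n : ℝ) - 2) ≤
            2 * ({e : Sym2 (Fin n) | ¬ e.IsDiag ∧ pairPerm σ e ≠ e}.ncard : ℝ) := by
          have := card_support_mul_le σ
          have h2 : ((n - 2 : ℕ) : ℝ) = (n : ℝ) - 2 := by
            rw [Nat.cast_sub (by omega)]; norm_num
          rw [← h2]
          exact_mod_cast this
        have := mul_le_mul_of_nonneg_left hc hδ0
        linarith
    · simp only [hσ, false_and]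
      have : {_ω : Outcome n | False} = ∅ := by ext; simp
      rw [this, measureReal_empty]
      positivity
  -- Here δ ≥ 12 log n / n and (n - 2)/2 ≥ n/4, so the exponent is at least 3 log n: this is where
  -- 48 = 4 · 4 · 3 comes from.
  · apply Real.exp_le_exp.2
    rw [div_le_iff₀ hn'] at hden
    have h4 : (n : ℝ) / 2 ≤ n - 2 := by linarith
    have := mul_le_mul_of_nonneg_left h4 hδ0
    have hd : P.α * (P.s₁ * P.s₂) = 4 * δ := by rw [hδ]; ring
    rw [hd] at hden
    linarith

end Params

/-- The harmonic-type sampling factor is at most half the product of the sampling probabilities. -/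
theorem sampling_factor_le {s₁ s₂ : ℝ} (h₁ : 0 < s₁) (h₁' : s₁ ≤ 1) (h₂ : 0 < s₂) (h₂' : s₂ ≤ 1) :
    s₁ ^ 2 * s₂ ^ 2 / (s₁ + s₂) ≤ s₁ * s₂ / 2 := by
  rw [div_le_div_iff₀ (by positivity) two_pos]
  have h12 : 0 < s₁ * s₂ := by positivity
  have : s₁ * s₂ * 2 ≤ s₁ + s₂ := by nlinarith
  nlinarith

end Deanon

/-! ### Conclusion -/

theorem theorem4p1 :
    ∃ C : ℝ, 0 < C ∧
      ∀ (P : ∀ n : ℕ, Deanon.Params n) (π₀ : ∀ n : ℕ, Equiv.Perm (Fin n)) (γ f g : ℕ → ℝ),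
        (∀ n, π₀ n ∈ (P n).mappings) →
        Tendsto (fun n => (P n).α) atTop (𝓝 0) →
        Tendsto (fun n => (P n).β) atTop (𝓝 0) →
        (∀ n, (P n).s₁ < 1) →
        (∀ n, (P n).s₂ < 1) →
        ¬ Tendsto (fun n => (P n).s₁) atTop (𝓝 1) →
        ¬ Tendsto (fun n => (P n).s₂) atTop (𝓝 1) →
        (∀ᶠ n in atTop, Real.log (P n).α / Real.log (P n).β ≤ γ n) →
        (∀ᶠ n in atTop,
          (P n).α * (1 - (P n).β) ^ 2 * (P n).s₁ ^ 2 * (P n).s₂ ^ 2 * Real.log (1 / (P n).α) /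
            ((P n).s₁ + (P n).s₂) = f n + g n) →
        (∀ᶠ n : ℕ in atTop, C * (γ n * Real.log n ^ 2 / n) ≤ f n) →
        Tendsto (fun n : ℕ => g n / (1 / (n : ℝ))) atTop atTop →
        Tendsto
          (fun n => (P n).law
            {ω | (P n).IsTheMinimizer (Deanon.published ω) (Deanon.auxiliary (π₀ n) ω) (π₀ n)})
          atTop (𝓝 1) := by
  refine ⟨48, by norm_num, fun P π₀ γ f g hπ₀ _ hβ h₁' h₂' _ _ hγ hfg hf hg => ?_⟩
  have hbound : ∀ᶠ n : ℕ in atTop, (P n).law.real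
      {ω | ¬ (P n).IsTheMinimizer (Deanon.published ω) (Deanon.auxiliary (π₀ n) ω) (π₀ n)} ≤
        Real.exp (1 / (n : ℝ)) - 1 := by
    have hβ6 : ∀ᶠ n in atTop, (P n).β ≤ 1 / 6 :=
      (hβ.eventually_lt_const (by norm_num)).mono fun n h => h.le
    filter_upwards [hβ6, hγ, hfg, hf, hg.eventually_gt_atTop 0, eventually_ge_atTop 4] with
      n hβn hγn hfgn hfn hgn hn
    have hn0 : (0 : ℝ) < n := by positivity
    have hg0 : 0 < g n := by
      rw [div_div_eq_mul_div, div_one] at hgn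
      exact pos_of_mul_pos_left hgn hn0.le
    have hα0 := (P n).α_nonneg
    have s1 := (P n).s₁_mem.1
    have s2 := (P n).s₂_mem.1
    let a₀ : Fin (P n).κ := (P n).c ⟨0, by omega⟩
    have hαβ : (P n).α ≤ (P n).β := ((P n).α_le a₀ a₀).trans ((P n).le_β a₀ a₀)
    have hlogβ : Real.log (P n).β ≤ 0 := Real.log_nonpos (hα0.trans hαβ) (by linarith)
    have hlogα : Real.log (P n).α ≤ 0 := Real.log_nonpos hα0 (by linarith)
    -- This weak bound holds even if α = 0, where the logarithm takes its default value 0. It gives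
    -- f + g > 0, which then forces α, s₁, s₂ > 0, and only after that does γ ≥ 1 follow.
    have hγ0 : 0 ≤ γ n := (div_nonneg_of_nonpos hlogα hlogβ).trans hγn
    have hf0 : 0 ≤ f n := le_trans (by positivity) hfn
    have hLpos : 0 < f n + g n := by linarith
    rw [← hfgn] at hLpos
    have hα : 0 < (P n).α := hα0.lt_of_ne fun h => by simp [← h] at hLpos
    have h₁ : 0 < (P n).s₁ := s1.lt_of_ne fun h => by simp [← h] at hLpos
    have h₂ : 0 < (P n).s₂ := s2.lt_of_ne fun h => by simp [← h] at hLpos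
    have hγ1 : 1 ≤ γ n := by
      refine le_trans ?_ hγn
      have hb : Real.log (P n).β < 0 := Real.log_neg (hα.trans_le hαβ) (by linarith)
      rw [one_le_div_of_neg hb]
      exact Real.log_le_log hα hαβ
    refine (P n).law_real_not_minimizer_le (hπ₀ n) hn hα hβn h₁ (h₁' n) h₂ (h₂' n) ?_
    have hl1 : 0 ≤ Real.log (1 / (P n).α) := by
      rw [one_div, Real.log_inv]; linarith
    refine Deanon.le_of_log_sq_le (by norm_num) hα (by linarith) (by positivity)
      (mul_le_one₀ (h₁' n).le s2 (h₂' n).le) (by exact_mod_cast (by omega : 3 ≤ n)) ?_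
    calc 48 * Real.log n ^ 2 / n = 48 * (1 * Real.log n ^ 2 / n) := by ring
      _ ≤ 48 * (γ n * Real.log n ^ 2 / n) := by gcongr
      _ ≤ f n + g n := by linarith
      _ = (P n).α * Real.log (1 / (P n).α) * ((1 - (P n).β) ^ 2 *
          ((P n).s₁ ^ 2 * (P n).s₂ ^ 2 / ((P n).s₁ + (P n).s₂))) := by rw [← hfgn]; ring
      _ ≤ (P n).α * Real.log (1 / (P n).α) * (1 * ((P n).s₁ * (P n).s₂ / 2)) := by
        have hb : (1 - (P n).β) ^ 2 ≤ 1 := pow_le_one₀ (by linarith) (by linarith)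
        have := Deanon.sampling_factor_le h₁ (h₁' n).le h₂ (h₂' n).le
        gcongr
      _ = _ := by ring
  have hlim : Tendsto (fun n : ℕ => Real.exp (1 / (n : ℝ)) - 1) atTop (𝓝 0) := by
    have := (Real.continuous_exp.tendsto 0).comp (tendsto_one_div_atTop_nhds_zero_nat (𝕜 := ℝ))
    simpa using this.sub_const 1
  have hbad := squeeze_zero' (Eventually.of_forall fun n => measureReal_nonneg) hbound hlim
  have hgood : Tendsto (fun n => (P n).law.real
      {ω | (P n).IsTheMinimizer (Deanon.published ω) (Deanon.auxiliary (π₀ n) ω) (π₀ n)})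
      atTop (𝓝 1) := by
    have := hbad.const_sub 1
    rw [sub_zero] at this
    refine this.congr fun n => ?_
    rw [← probReal_compl_eq_one_sub (Set.toFinite _).measurableSet]
    congr 1
    ext ω; simp
  have := ENNReal.tendsto_ofReal hgood
  simpa [ofReal_measureReal] using this
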